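/- Let $(X,d)$ be a metric space and let $f\colon X\to[-\infty,+\infty]$ be lower semicontinuous. Put $\mathcal D[f]=\{x\in X: f(x)\neq\pm\infty\}$. Fix $K\in\mathbb R$ and $N<0$, set $f_N=e^{-f/N}$ (so $f_N=0$ where $f=-\infty$ and $f_N=+\infty$ where $f=+\infty$), and, for $\theta\ge 0$, $$\mathfrak s_{K,N}(\theta)=\begin{cases}\frac{1}{\sqrt{K/N}}\sin\bigl(\theta\sqrt{K/N}\bigr)&K<0,\\ \theta&K=0,\\ \frac{1}{\sqrt{-K/N}}\sinh\bigl(\theta\sqrt{-K/N}\bigr)&K>0.\end{cases}$$ For a real function $u$ write $\frac{d^+}{dt}u(t)=\limsup_{h\downarrow0}\frac{u(t+h)-u(t)}{h}\in[-\infty,+\infty]$. Let $T\in(0,+\infty]$. An $\mathrm{EVI}_{K,N}$ gradient curve for $f$ is a continuous curve $(y_t)_{t\in(0,T)}$ in $X$ with $y_t\in\mathcal D[f]$ for every $t\in(0,T)$, such that $$\frac{d^+}{dt}\Bigl[\mathfrak s_{K,N}\bigl(\tfrac{d(y_t,z)}{2}\bigr)^2\Bigr]+K\,\mathfrak s_{K,N}\bigl(\tfrac{d(y_t,z)}{2}\bigr)^2\le\frac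 N2\Bigl(1-\frac{f_N(z)}{f_N(y_t)}\Bigr)$$ for every $t\in(0,T)$ and every $z\in\overline{\mathcal D[f]}$ (the closure of $\mathcal D[f]$), with $d(y_t,z)<\pi\sqrt{N/K}$ if $K<0$; the inequality is read in $[-\infty,+\infty]$ and is thus trivially true when $f(z)=+\infty$. Then every $\mathrm{EVI}_{K,N}$ gradient curve $(y_t)_{t\in(0,T)}$ for $f$ is locally Lipschitz on $(0,T)$: every $t\in(0,T)$ has a neighbourhood in $(0,T)$ on which $y$ is Lipschitz. -/

import Mathlib

open Filter Topology Set

noncomputable section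

/-- The open time interval `(0,T)`, for `T ∈ (0,+∞]`. -/
def timeInterval (T : EReal) : Set ℝ := {t : ℝ | 0 < t ∧ (t : EReal) < T}

/-- The finiteness domain `{x | f x ≠ ±∞}` of an extended-real functional. -/
def finDomain {X : Type*} (f : X → EReal) : Set X := {x | f x ≠ ⊥ ∧ f x ≠ ⊤}

/-- The upper right (Dini) derivative `limsup_{h ↓ 0} (u (t + h) - u t) / h`, in `[-∞,+∞]`. -/
def upperRightDeriv (u : ℝ → ℝ) (t : ℝ) : EReal :=
  limsup (fun h : ℝ => (((u (t + h) - u t) / h : ℝ) : EReal)) (𝓝[>] (0 : ℝ))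

/-- The generalized sine function `𝔰_{K,N}`, for `N < 0`. -/
def sKN (K N θ : ℝ) : ℝ :=
  if K < 0 then Real.sin (θ * √(K / N)) / √(K / N)
  else if K = 0 then θ
  else Real.sinh (θ * √(-K / N)) / √(-K / N)

/-- `f_N = exp (-f / N)`, with values in `[0,+∞]`; for `N < 0` it is `0` where `f = -∞` and
`+∞` where `f = +∞`. -/
def expFun {X : Type*} (N : ℝ) (f : X → EReal) (x : X) : ENNReal :=
  EReal.exp (-(f x) / (N : EReal))

/-- `y` (restricted to `(0,T)`; the values elsewhere are irrelevant) is an `EVI_{K,N}` gradient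
curve for `f`. The inequality is read in `[-∞,+∞]`, so it holds trivially
at points `z` with `f z = +∞`. -/
structure IsEVIGradientCurve {X : Type*} [MetricSpace X] (K N : ℝ) (f : X → EReal)
    (T : EReal) (y : ℝ → X) : Prop where
  continuousOn : ContinuousOn y (timeInterval T)
  mem_domain : ∀ t ∈ timeInterval T, y t ∈ finDomain f
  evi : ∀ t ∈ timeInterval T, ∀ z ∈ closure (finDomain f),
    (K < 0 → dist (y t) z < Real.pi * √(N / K)) →
    upperRightDeriv (fun r => sKN K N (dist (y r) z / 2) ^ 2) t
        + ((K * sKN K N (dist (y t) z / 2) ^ 2 : ℝ) : EReal)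
      ≤ ((N / 2 : ℝ) : EReal) * (1 - ((expFun N f z / expFun N f (y t) : ENNReal) : EReal))

end

/-! Only test points on the curve are needed. Put u(s,c) = 𝔰(d(y_s,y_c)/2)² and φ(t) = f_N(y_t); the
EVI bounds the upper right derivative of u in s by |K| u + m (φ(c)/φ(s) - 1), where m = -N/2.
Grönwall then makes φ decreasing (`antitoneOn_of_evi`).

In the new time τ = ∫ 1/φ the forcing becomes m (φ(c) - φ(s)). Applied to both arguments of the
symmetric u, these terms telescope, so u grows at most exponentially when both times are translated
together (`translate_le_exp_mul`). Being monotone, φ is differentiable in τ at some slightly earlier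
time; there the EVI tested at the starting point gives u = O(h²), and translation carries this
forward (`exists_le_mul_sq`). Since τ is Lipschitz on compact intervals and 𝔰 is linearly bounded
below (`mul_le_sKN`), it follows that d = O(h). -/

/-! ### One-sided Grönwall estimate -/

/-- A Grönwall inequality for upper right Dini derivatives, with a forcing term `A * τ'`. -/
theorem le_of_slope_right_lt {u τ τ' : ℝ → ℝ} {κ A p q : ℝ} (hκ : 0 ≤ κ) (hpq : p ≤ q)
    (hu : ContinuousOn u (Icc p q)) (hτc : ContinuousOn τ (Icc p q))
    (hτ : ∀ r ∈ Ico p q, HasDerivWithinAt τ (τ' r) (Ici r) r) (hpos : ∀ r ∈ Ico p q, 0 < τ' r)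
    (hd : ∀ r ∈ Ico p q, ∀ v, κ * u r + A * τ' r < v → ∀ᶠ z in 𝓝[>] r, slope u r z < v) :
    u q ≤ Real.exp (κ * (q - p)) * u p
      + (A + |A| * (Real.exp (κ * (q - p)) - 1)) * (τ q - τ p) := by
  set E := Real.exp (κ * (q - p)) with hE
  have hE1 : 1 ≤ E := Real.one_le_exp (mul_nonneg hκ (by linarith))
  have hE0 : 0 < E := by linarith
  -- The weight G ∈ [1, E] multiplies the forcing, which hurts when A < 0; this A' satisfies A ≤ G
  -- A' for either sign of A.
  set A' := (A + |A| * (E - 1)) / E with hA'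
  have hEA' : E * A' = A + |A| * (E - 1) := by rw [hA']; field_simp
  -- The comparison principle needs a strict derivative inequality; η supplies it and then tends to
  -- 0.
  have key : ∀ η > 0, u q ≤ E * (u p + (A' + η) * (τ q - τ p)) := by
    intro η hη
    refine image_le_of_liminf_slope_right_lt_deriv_boundary'
      (B := fun r => Real.exp (κ * (r - p)) * (u p + (A' + η) * (τ r - τ p)))
      (B' := fun r => Real.exp (κ * (r - p)) * κ * (u p + (A' + η) * (τ r - τ p))
        + Real.exp (κ * (r - p)) * ((A' + η) * τ' r)) hu
      (fun r hr v hv => (hd r hr v hv).frequently) (by simp) ?_ ?_ ?_ (right_mem_Icc.2 hpq)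
    · fun_prop
    · intro r hr
      have h1 : HasDerivWithinAt (fun r => Real.exp (κ * (r - p)))
          (Real.exp (κ * (r - p)) * κ) (Ici r) r := by
        have := ((((hasDerivAt_id r).sub_const p).const_mul κ).exp).hasDerivWithinAt (s := Ici r)
        simpa using this
      exact h1.mul (((((hτ r hr).sub_const _).const_mul _)).const_add _)
    · intro r hr hur
      have hG1 : 1 ≤ Real.exp (κ * (r - p)) :=
        Real.one_le_exp (mul_nonneg hκ (by linarith [hr.1]))
      have hGE : Real.exp (κ * (r - p)) ≤ E :=
        Real.exp_le_exp.2 (mul_le_mul_of_nonneg_left (by linarith [hr.2]) hκ)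
      set G := Real.exp (κ * (r - p))
      have hGA : A ≤ G * A' := by
        rw [hA', mul_div_assoc', le_div_iff₀ hE0]
        rcases le_total 0 A with h | h
        · rw [abs_of_nonneg h]; nlinarith [mul_nonneg h hE0.le]
        · rw [abs_of_nonpos h]
          nlinarith [mul_nonneg (neg_nonneg.2 h) (sub_nonneg.2 hGE),
            mul_nonneg (mul_nonneg (neg_nonneg.2 h) (sub_nonneg.2 hE1))
              (by linarith : 0 ≤ G)]
      have hG : A < G * (A' + η) := by nlinarith
      have := mul_lt_mul_of_pos_right hG (hpos r hr)
      have h2 : G * κ * (u p + (A' + η) * (τ r - τ p)) = κ * u r := by rw [hur]; ring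
      rw [h2]; linarith
  have hlim : Tendsto (fun η : ℝ => E * (u p + (A' + η) * (τ q - τ p))) (𝓝[>] 0)
      (𝓝 (E * (u p + (A' + 0) * (τ q - τ p)))) :=
    (Continuous.tendsto (by fun_prop) _).mono_left nhdsWithin_le_nhds
  have := ge_of_tendsto hlim (eventually_mem_nhdsWithin.mono fun η hη => key η hη)
  rw [← hEA']; linarith

/-! ### Discrete evolution variational inequality -/

/-- A discrete evolution variational inequality for a symmetric `F` implies exponential control
of `F` along simultaneous translations. -/
theorem translate_le_exp_mul {F : ℝ → ℝ → ℝ} {ψ : ℝ → ℝ} {κ m B Λ : ℝ} (hκ : 0 ≤ κ) (hm : 0 ≤ m)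
    (hsymm : ∀ x y, F x y = F y x) (hψ : AntitoneOn ψ (Icc 0 Λ))
    (hB : ∀ x ∈ Icc 0 Λ, ∀ y ∈ Icc 0 Λ, m * (ψ x - ψ y) ≤ B)
    (hF : ∀ x ∈ Icc 0 Λ, ∀ y ∈ Icc 0 Λ, x ≤ y → ∀ c ∈ Icc 0 Λ,
      F y c ≤ Real.exp (κ * (y - x)) * F x c
        + (m * (ψ c - ψ y) + B * (Real.exp (κ * (y - x)) - 1)) * (y - x))
    {x y L : ℝ} (hx : 0 ≤ x) (hy : 0 ≤ y) (hL : 0 ≤ L) (hxL : x + L ≤ Λ) (hyL : y + L ≤ Λ) :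
    F (x + L) (y + L) ≤ Real.exp (2 * κ * L) * F x y := by
  have hxI : x ∈ Icc 0 Λ := ⟨hx, by linarith⟩
  have hB0 : 0 ≤ B := by simpa using hB x hxI x hxI
  have main : ∀ n : ℕ, F (x + L) (y + L) ≤ Real.exp (2 * κ * L) * (F x y
      + (B * (L / (n + 1)) + B * (Real.exp (κ * (L / (n + 1))) - 1)
        * (2 + Real.exp (κ * (L / (n + 1)))) * L)) := by
    intro n
    have hn : (0 : ℝ) < n + 1 := by positivity
    set ε := L / (n + 1) with hε
    have hε0 : 0 ≤ ε := by positivity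
    have hnε : (n + 1) * ε = L := by rw [hε]; field_simp
    set E := Real.exp (κ * ε) with hE
    have hE1 : 1 ≤ E := Real.one_le_exp (by positivity)
    set R := B * (E - 1) * (2 + E) with hR
    have hR0 : 0 ≤ R := by have := sub_nonneg.2 hE1; positivity
    have step : ∀ x' ∈ Icc 0 Λ, ∀ y' ∈ Icc 0 Λ, x' + ε ∈ Icc 0 Λ → y' + ε ∈ Icc 0 Λ →
        F (x' + ε) (y' + ε) ≤ E ^ 2 * F x' y' + (m * (ψ x' - ψ (x' + ε)) + R) * ε := by
      intro x' hx' y' hy' hx'' hy''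
      -- Move the first argument testing at y' + ε, then the second testing at x': the values ψ (y'
      -- + ε) cancel up to the factor E, whose cost is absorbed in R.
      have h1 := hF x' hx' (x' + ε) hx'' (by linarith) (y' + ε) hy''
      have h2 := hF y' hy' (y' + ε) hy'' (by linarith) x' hx'
      have h3 := hB x' hx' (y' + ε) hy''
      rw [hsymm y' x', hsymm _ x'] at h2
      simp only [add_sub_cancel_left, ← hE] at h1 h2
      have h4 := mul_le_mul_of_nonneg_left h2 (by linarith : 0 ≤ E)
      have h5 := mul_nonneg (mul_nonneg (sub_nonneg.2 h3) (sub_nonneg.2 hE1)) hε0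
      rw [hR]; linarith
    -- The ψ-terms telescope, so all steps together contribute at most B ε, which vanishes as ε → 0.
    have ind : ∀ k : ℕ, (k : ℝ) ≤ n + 1 → F (x + k * ε) (y + k * ε) ≤ E ^ (2 * k) * (F x y
        + (m * (ψ x - ψ (x + k * ε)) + k * R) * ε) := by
      intro k
      induction k with
      | zero => intro _; simp
      | succ k ih =>
        intro hk
        push_cast at hk ⊢
        have hk0 : (0 : ℝ) ≤ k * ε := by positivity
        have hk1 : (k + 1) * ε ≤ L := by
          rw [← hnε]; exact mul_le_mul_of_nonneg_right hk hε0
        have hxk : x + k * ε ∈ Icc 0 Λ := ⟨by linarith, by linarith⟩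
        have hyk : y + k * ε ∈ Icc 0 Λ := ⟨by linarith, by linarith⟩
        have hxk' : x + k * ε + ε ∈ Icc 0 Λ := ⟨by linarith, by linarith⟩
        have hyk' : y + k * ε + ε ∈ Icc 0 Λ := ⟨by linarith, by linarith⟩
        have h1 := step _ hxk _ hyk hxk' hyk'
        have h2 := mul_le_mul_of_nonneg_left (ih (by linarith)) (by positivity : 0 ≤ E ^ 2)
        have h3 : 0 ≤ (m * (ψ (x + k * ε) - ψ (x + k * ε + ε)) + R) * ε := by
          have := hψ hxk hxk' (by linarith)
          have := mul_nonneg hm (sub_nonneg.2 this)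
          positivity
        have h4 := le_mul_of_one_le_left h3 (one_le_pow₀ hE1 : 1 ≤ E ^ (2 * (k + 1)))
        have e1 : x + (k + 1) * ε = x + k * ε + ε := by ring
        have e2 : y + (k + 1) * ε = y + k * ε + ε := by ring
        rw [e1, e2]
        have h5 : E ^ 2 * (E ^ (2 * k) * (F x y + (m * (ψ x - ψ (x + k * ε)) + k * R) * ε))
          = E ^ (2 * (k + 1)) * (F x y + (m * (ψ x - ψ (x + k * ε)) + k * R) * ε) := by ring
        linarith
    have h := ind (n + 1) (by push_cast; rfl)
    push_cast at h
    rw [hnε] at h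
    have hEp : E ^ (2 * (n + 1)) = Real.exp (2 * κ * L) := by
      rw [hE, ← Real.exp_nat_mul]
      push_cast
      rw [← hnε]; ring_nf
    rw [hEp] at h
    refine h.trans (mul_le_mul_of_nonneg_left ?_ (Real.exp_pos _).le)
    have h6 := mul_le_mul_of_nonneg_right (hB x hxI (x + L) ⟨by linarith, hxL⟩) hε0
    have h7 : (n + 1) * R * ε = R * L := by rw [← hnε]; ring
    linarith
  have h0 : Tendsto (fun n : ℕ => L / ((n : ℝ) + 1)) atTop (𝓝 0) := by
    simpa [div_eq_mul_inv] using (tendsto_one_div_add_atTop_nhds_zero_nat (𝕜 := ℝ)).const_mul L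
  have hg : Continuous fun ε : ℝ => Real.exp (2 * κ * L) * (F x y
      + (B * ε + B * (Real.exp (κ * ε) - 1) * (2 + Real.exp (κ * ε)) * L)) := by fun_prop
  have := ge_of_tendsto' ((hg.tendsto 0).comp h0) main
  simpa using this

/-- Under the same discrete evolution variational inequality, `F (x + h) x = O(h ^ 2)` as `h ↓ 0`,
locally uniformly in `x`. -/
theorem exists_le_mul_sq {F : ℝ → ℝ → ℝ} {ψ : ℝ → ℝ} {κ m B Λ x₀ : ℝ} (hκ : 0 ≤ κ) (hm : 0 ≤ m)
    (hsymm : ∀ x y, F x y = F y x) (hnn : ∀ x y, 0 ≤ F x y) (hdiag : ∀ x, F x x = 0)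
    (hψ : AntitoneOn ψ (Icc 0 Λ))
    (hB : ∀ x ∈ Icc 0 Λ, ∀ y ∈ Icc 0 Λ, m * (ψ x - ψ y) ≤ B)
    (hF : ∀ x ∈ Icc 0 Λ, ∀ y ∈ Icc 0 Λ, x ≤ y → ∀ c ∈ Icc 0 Λ,
      F y c ≤ Real.exp (κ * (y - x)) * F x c
        + (m * (ψ c - ψ y) + B * (Real.exp (κ * (y - x)) - 1)) * (y - x))
    (hx₀ : 0 < x₀) (hx₀' : x₀ ≤ Λ) :
    ∃ x₁ < x₀, ∃ δ > 0, ∃ C, ∀ x y, x₁ ≤ x → x ≤ y → y ≤ Λ → y - x < δ →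
      F y x ≤ C * (y - x) ^ 2 := by
  -- Lebesgue: a monotone function is differentiable almost everywhere.
  obtain ⟨x₁, hx₁, hdψ⟩ : ∃ x₁ ∈ Ioo 0 x₀, DifferentiableAt ℝ ψ x₁ := by
    have hae := (hψ.mono (show Ioo 0 x₀ ⊆ Icc 0 Λ from
      fun z hz => ⟨hz.1.le, hz.2.le.trans hx₀'⟩)).neg.ae_differentiableWithinAt_of_mem
    have : ∃ᵐ z, z ∈ Ioo 0 x₀ := by
      rw [MeasureTheory.frequently_ae_mem_iff]
      simpa using hx₀
    obtain ⟨z, hz, hz'⟩ := (this.and_eventually hae).exists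
    have := ((hz' hz).differentiableAt (Ioo_mem_nhds hz.1 hz.2)).neg
    exact ⟨z, hz, by simpa using this⟩
  have hdiff : DifferentiableAt ℝ
      (fun h => - m * ψ (x₁ + h) + B * (Real.exp (κ * h) - 1)) 0 := by
    have : DifferentiableAt ℝ (fun h => ψ (x₁ + h)) 0 :=
      DifferentiableAt.comp (g := ψ) (f := fun h => x₁ + h) 0 (by simpa using hdψ) (by fun_prop)
    exact (this.const_mul _).add (by fun_prop)
  obtain ⟨C, hC⟩ := hdiff.isBigO_sub.bound
  obtain ⟨δ, hδ, hball⟩ := Metric.eventually_nhds_iff.1 hC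
  refine ⟨x₁, hx₁.2, δ, hδ, Real.exp (2 * κ * Λ) * C, fun x y hx hxy hy hyx => ?_⟩
  have hx₁I : x₁ ∈ Icc 0 Λ := ⟨hx₁.1.le, by linarith [hx₁.2]⟩
  -- Starting and testing both at x₁ leaves an increment of ψ, which is O(h), times h.
  have h1 := hF x₁ hx₁I (x₁ + (y - x)) ⟨by linarith [hx₁.1], by linarith⟩ (by linarith) x₁ hx₁I
  have h2 := hball (y := y - x) (by simpa [abs_of_nonneg (sub_nonneg.2 hxy)] using hyx)
  simp only [sub_zero, add_zero, mul_zero, Real.exp_zero, sub_self, Real.norm_eq_abs,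
    abs_of_nonneg (sub_nonneg.2 hxy)] at h2
  have h3 := mul_le_mul_of_nonneg_right ((le_abs_self _).trans h2) (sub_nonneg.2 hxy)
  rw [hdiag, add_sub_cancel_left] at h1
  have h4 : F (x₁ + (y - x)) x₁ ≤ C * (y - x) ^ 2 := by linarith
  have h5 := translate_le_exp_mul hκ hm hsymm hψ hB hF (x := x₁ + (y - x)) (y := x₁) (L := x - x₁)
    (by linarith [hx₁.1]) hx₁.1.le (by linarith) (by linarith) (by linarith)
  have e1 : x₁ + (y - x) + (x - x₁) = y := by ring
  have e2 : x₁ + (x - x₁) = x := by ring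
  rw [e1, e2] at h5
  have h6 : Real.exp (2 * κ * (x - x₁)) ≤ Real.exp (2 * κ * Λ) :=
    Real.exp_le_exp.2 (mul_le_mul_of_nonneg_left (by linarith [hx₁.1]) (by positivity))
  calc F y x ≤ Real.exp (2 * κ * (x - x₁)) * F (x₁ + (y - x)) x₁ := h5
    _ ≤ Real.exp (2 * κ * Λ) * (C * (y - x) ^ 2) :=
      mul_le_mul h6 h4 (hnn _ _) (Real.exp_pos _).le
    _ = _ := by ring

/-! ### Monotone energy and the time change -/

section AbstractEVI

variable {u : ℝ → ℝ → ℝ} {φ : ℝ → ℝ} {κ m a b : ℝ}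

/-- The energy decreases along a curve satisfying an evolution variational inequality. -/
theorem antitoneOn_of_evi (hκ : 0 ≤ κ) (hm : 0 ≤ m) (hnn : ∀ p q, 0 ≤ u p q)
    (hdiag : ∀ p, u p p = 0)
    (hcont : ∀ c ∈ Icc a b, ContinuousOn (fun s => u s c) (Icc a b))
    (hpos : ∀ t ∈ Icc a b, 0 < φ t) (hlsc : LowerSemicontinuousOn φ (Icc a b))
    (hzero : ∀ p ∈ Icc a b, ∀ q ∈ Icc a b, u p q = 0 → φ p = φ q)
    (hd : ∀ r ∈ Ico a b, ∀ c ∈ Icc a b, ∀ v, κ * u r c + m * (φ c / φ r - 1) < v →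
      ∀ᶠ z in 𝓝[>] r, slope (fun s => u s c) r z < v) :
    AntitoneOn φ (Icc a b) := by
  intro s hs t ht hst
  have hsub : Icc s t ⊆ Icc a b := Icc_subset_Icc hs.1 ht.2
  -- Tested at a minimiser r, the forcing is nonpositive after r, so u stays 0 and φ keeps its
  -- minimal value up to t.
  obtain ⟨r, hr, hmin⟩ := (hlsc.mono hsub).exists_isMinOn (nonempty_Icc.2 hst) isCompact_Icc
  have hsub' : Icc r t ⊆ Icc s t := Icc_subset_Icc_left hr.1
  have h := le_of_slope_right_lt (τ := id) (τ' := fun _ => 1) (A := 0) hκ hr.2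
    ((hcont r (hsub hr)).mono (hsub'.trans hsub)) continuousOn_id
    (fun x _ => (hasDerivAt_id x).hasDerivWithinAt) (fun _ _ => one_pos) (fun x hx v hv => by
      have hx' := hsub' ⟨hx.1, hx.2.le⟩
      refine hd x ⟨(hsub hx').1, hx.2.trans_le ht.2⟩ r (hsub hr) v (lt_of_le_of_lt ?_ hv)
      have h1 : φ r / φ x ≤ 1 := (div_le_one (hpos x (hsub hx'))).2 (hmin hx')
      have := mul_nonneg hm (sub_nonneg.2 h1)
      linarith)
  simp only [hdiag, mul_zero, abs_zero, zero_mul, add_zero] at h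
  rw [hzero t ht r (hsub hr) (le_antisymm h (hnn _ _))]
  exact hmin ⟨le_rfl, hst⟩

/-- A curve satisfying an evolution variational inequality for `u` has `u t s = O((t - s) ^ 2)`
near every interior time. -/
theorem exists_le_mul_sq_of_evi (hκ : 0 ≤ κ) (hm : 0 ≤ m) (hsymm : ∀ p q, u p q = u q p)
    (hnn : ∀ p q, 0 ≤ u p q) (hdiag : ∀ p, u p p = 0)
    (hcont : ∀ c ∈ Icc a b, ContinuousOn (fun s => u s c) (Icc a b))
    (hpos : ∀ t ∈ Icc a b, 0 < φ t) (hlsc : LowerSemicontinuousOn φ (Icc a b))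
    (hzero : ∀ p ∈ Icc a b, ∀ q ∈ Icc a b, u p q = 0 → φ p = φ q)
    (hd : ∀ r ∈ Ico a b, ∀ c ∈ Icc a b, ∀ v, κ * u r c + m * (φ c / φ r - 1) < v →
      ∀ᶠ z in 𝓝[>] r, slope (fun s => u s c) r z < v) {t₀ : ℝ} (ht₀ : t₀ ∈ Ioo a b) :
    ∃ C, ∃ δ > 0, ∀ s t, |s - t₀| < δ → |t - t₀| < δ → s ≤ t → u t s ≤ C * (t - s) ^ 2 := by
  have hanti := antitoneOn_of_evi hκ hm hnn hdiag hcont hpos hlsc hzero hd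
  have hab : a ≤ b := (ht₀.1.trans ht₀.2).le
  have haI : a ∈ Icc a b := left_mem_Icc.2 hab
  have hbI : b ∈ Icc a b := right_mem_Icc.2 hab
  have hinvmono : MonotoneOn (fun r => (φ r)⁻¹) (Icc a b) := fun x hx y hy hxy =>
    inv_anti₀ (hpos y hy) (hanti hx hy hxy)
  have hint : ∀ p ∈ Icc a b, ∀ q ∈ Icc a b, p ≤ q →
      IntervalIntegrable (fun r => (φ r)⁻¹) MeasureTheory.volume p q := fun p hp q hq hpq =>
    (hinvmono.mono (by rw [uIcc_of_le hpq]; exact Icc_subset_Icc hp.1 hq.2)).intervalIntegrable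
  set τ : ℝ → ℝ := fun t => ∫ r in a..t, (φ r)⁻¹ with hτdef
  have hτsub : ∀ p ∈ Icc a b, ∀ q ∈ Icc a b, p ≤ q → τ q - τ p = ∫ r in p..q, (φ r)⁻¹ :=
    fun p hp q hq hpq => by
      have := intervalIntegral.integral_add_adjacent_intervals
        (hint a haI p hp hp.1) (hint p hp q hq hpq)
      simp only [hτdef]; linarith
  have hτlow : ∀ p ∈ Icc a b, ∀ q ∈ Icc a b, p ≤ q → (q - p) * (φ a)⁻¹ ≤ τ q - τ p :=
    fun p hp q hq hpq => by
      rw [hτsub p hp q hq hpq]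
      have := intervalIntegral.integral_mono_on (f := fun _ => (φ a)⁻¹) hpq (by simp)
        (hint p hp q hq hpq) (fun x hx => hinvmono haI ⟨hp.1.trans hx.1, hx.2.trans hq.2⟩
          (hp.1.trans hx.1))
      simpa using this
  have hτup : ∀ p ∈ Icc a b, ∀ q ∈ Icc a b, p ≤ q → τ q - τ p ≤ (q - p) * (φ b)⁻¹ :=
    fun p hp q hq hpq => by
      rw [hτsub p hp q hq hpq]
      have := intervalIntegral.integral_mono_on (g := fun _ => (φ b)⁻¹) hpq
        (hint p hp q hq hpq) (by simp) (fun x hx => hinvmono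
          ⟨hp.1.trans hx.1, hx.2.trans hq.2⟩ hbI (hx.2.trans hq.2))
      simpa using this
  have hφa : 0 < φ a := hpos a haI
  have hφb : 0 < φ b := hpos b hbI
  have hτmono : StrictMonoOn τ (Icc a b) := fun p hp q hq hpq => by
    have := hτlow p hp q hq hpq.le
    have := mul_pos (sub_pos.2 hpq) (inv_pos.2 hφa)
    linarith
  have hτcont : ContinuousOn τ (Icc a b) := by
    have := intervalIntegral.continuousOn_primitive_interval' (hint a haI b hbI hab)
      (left_mem_uIcc)
    rwa [uIcc_of_le hab] at this
  -- Lower semicontinuity and monotonicity give right continuity, so τ has right derivative 1/φ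
  -- everywhere, not just almost everywhere.
  have hright : ∀ r ∈ Ico a b, ContinuousWithinAt φ (Ici r) r := by
    intro r hr
    have hrI : r ∈ Icc a b := ⟨hr.1, hr.2.le⟩
    have hmem : Icc r b ∈ 𝓝[≥] r := Icc_mem_nhdsGE hr.2
    refine tendsto_order.2 ⟨fun v hv => ?_, fun v hv => ?_⟩
    · exact ((hlsc r hrI v hv).filter_mono (nhdsWithin_le_of_mem (mem_of_superset hmem
        (Icc_subset_Icc_left hr.1))))
    · filter_upwards [hmem] with x hx
      exact (hanti hrI ⟨hr.1.trans hx.1, hx.2⟩ hx.1).trans_lt hv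
  have hτderiv : ∀ r ∈ Ico a b, HasDerivWithinAt τ (φ r)⁻¹ (Ici r) r := by
    intro r hr
    have hrI : r ∈ Icc a b := ⟨hr.1, hr.2.le⟩
    refine intervalIntegral.integral_hasDerivWithinAt_right (hint a haI r hrI hr.1)
      (t := Ioi r) ⟨Ioc a b, ?_, ?_⟩ (((hright r hr).inv₀ (hpos r hrI).ne').mono Ioi_subset_Ici_self)
    · exact mem_of_superset (Ioc_mem_nhdsGT hr.2) (Ioc_subset_Ioc_left hr.1)
    · exact (hint a haI b hbI hab).1.aestronglyMeasurable
  have hτa : τ a = 0 := by simp [hτdef]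
  have hex : ∀ x ∈ Icc 0 (τ b), ∃ r ∈ Icc a b, τ r = x := fun x hx => by
    have := intermediate_value_Icc hab hτcont
    rw [hτa] at this
    exact this hx
  choose! σ hσ hτσ using hex
  have hτI : ∀ t ∈ Icc a b, τ t ∈ Icc 0 (τ b) := fun t ht =>
    ⟨hτa ▸ hτmono.monotoneOn haI ht ht.1, hτmono.monotoneOn ht hbI ht.2⟩
  have hστ : ∀ t ∈ Icc a b, σ (τ t) = t := fun t ht =>
    hτmono.injOn (hσ _ (hτI t ht)) ht (hτσ _ (hτI t ht))
  have hσmono : MonotoneOn σ (Icc 0 (τ b)) := fun x hx y hy hxy => by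
    rw [← hτmono.le_iff_le (hσ x hx) (hσ y hy), hτσ x hx, hτσ y hy]
    exact hxy
  have hdiff : ∀ p ∈ Icc a b, ∀ q ∈ Icc a b, m * (φ p - φ q) ≤ m * φ a := fun p hp q hq =>
    mul_le_mul_of_nonneg_left (by linarith [hanti haI hp hp.1, hpos q hq]) hm
  -- The factors φ a come from 0 < φ ≤ φ a: elapsed original time is at most φ a times elapsed τ,
  -- and energy gaps are at most φ a.
  obtain ⟨x₁, hx₁, δ, hδ, C, hC⟩ := exists_le_mul_sq (F := fun x y => u (σ x) (σ y))
    (ψ := fun x => φ (σ x)) (κ := κ * φ a) (m := m) (B := m * φ a) (Λ := τ b) (x₀ := τ t₀)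
    (by positivity) hm (fun x y => hsymm _ _) (fun x y => hnn _ _) (fun x => hdiag _)
    (fun x hx y hy hxy => hanti (hσ x hx) (hσ y hy) (hσmono hx hy hxy))
    (fun x hx y hy => hdiff _ (hσ x hx) _ (hσ y hy))
    (fun x hx y hy hxy c hc => by
      have hp := hσ x hx
      have hq := hσ y hy
      have hpq := hσmono hx hy hxy
      have hsub : Icc (σ x) (σ y) ⊆ Icc a b := Icc_subset_Icc hp.1 hq.2
      have hsub' : Ico (σ x) (σ y) ⊆ Ico a b := Ico_subset_Ico hp.1 hq.2
      -- Before time σ y the energy is at least φ (σ y), so the forcing is at most a constant times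
      -- τ'.
      have h := le_of_slope_right_lt (u := fun s => u s (σ c)) (τ := τ) (τ' := fun r => (φ r)⁻¹)
        (A := m * (φ (σ c) - φ (σ y))) hκ hpq ((hcont _ (hσ c hc)).mono hsub) (hτcont.mono hsub)
        (fun r hr => hτderiv r (hsub' hr)) (fun r hr => inv_pos.2 (hpos r (hsub ⟨hr.1, hr.2.le⟩)))
        (fun r hr v hv => by
          have hrI := hsub ⟨hr.1, hr.2.le⟩
          refine hd r (hsub' hr) _ (hσ c hc) v (lt_of_le_of_lt ?_ hv)
          have h1 := mul_inv_cancel₀ (hpos r hrI).ne'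
          have h2 := mul_le_mul_of_nonneg_right (hanti hrI hq hr.2.le)
            (inv_pos.2 (hpos r hrI)).le
          have h3 := mul_le_mul_of_nonneg_left (h2.trans_eq h1) hm
          rw [div_eq_mul_inv]
          linarith)
      rw [hτσ x hx, hτσ y hy] at h
      have hexp : Real.exp (κ * (σ y - σ x)) ≤ Real.exp (κ * φ a * (y - x)) := by
        refine Real.exp_le_exp.2 ?_
        rw [mul_assoc]
        refine mul_le_mul_of_nonneg_left ?_ hκ
        have := hτlow _ hp _ hq hpq
        rwa [hτσ x hx, hτσ y hy, ← div_eq_mul_inv, div_le_iff₀ hφa, mul_comm] at this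
      have hexp1 : 1 ≤ Real.exp (κ * (σ y - σ x)) :=
        Real.one_le_exp (mul_nonneg hκ (sub_nonneg.2 hpq))
      have habs : |m * (φ (σ c) - φ (σ y))| ≤ m * φ a := by
        refine abs_le'.2 ⟨hdiff _ (hσ c hc) _ hq, ?_⟩
        have := hdiff _ hq _ (hσ c hc)
        linarith
      refine h.trans (add_le_add (mul_le_mul_of_nonneg_right hexp (hnn _ _))
        (mul_le_mul_of_nonneg_right (add_le_add le_rfl ?_) (sub_nonneg.2 hxy)))
      exact mul_le_mul habs (by linarith) (by linarith) (by positivity))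
    (by rw [← hτa]; exact hτmono haI ⟨ht₀.1.le, ht₀.2.le⟩ ht₀.1)
    (hτmono.monotoneOn ⟨ht₀.1.le, ht₀.2.le⟩ hbI ht₀.2.le)
  have hτat : ContinuousAt τ t₀ := hτcont.continuousAt (Icc_mem_nhds ht₀.1 ht₀.2)
  obtain ⟨ε, hε, hball⟩ := Metric.eventually_nhds_iff.1
    ((hτat.eventually_const_lt hx₁).and (Icc_mem_nhds ht₀.1 ht₀.2))
  refine ⟨max C 0 * (φ b)⁻¹ ^ 2, min ε (δ * φ b / 2), by positivity, fun s t hs ht hst => ?_⟩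
  obtain ⟨hs1, hs2⟩ := hball (y := s) (by rw [Real.dist_eq]; exact hs.trans_le (min_le_left _ _))
  obtain ⟨ht1, ht2⟩ := hball (y := t) (by rw [Real.dist_eq]; exact ht.trans_le (min_le_left _ _))
  have hsm := hτmono.monotoneOn hs2 ht2 hst
  have hup := hτup s hs2 t ht2 hst
  have hclose : τ t - τ s < δ := by
    refine hup.trans_lt ?_
    rw [← div_eq_mul_inv, div_lt_iff₀ hφb]
    have h1 := abs_lt.1 (hs.trans_le (min_le_right _ _))
    have h2 := abs_lt.1 (ht.trans_le (min_le_right _ _))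
    linarith [h1.1, h2.2]
  have := hC (τ s) (τ t) hs1.le hsm (hτmono.monotoneOn ht2 hbI ht2.2) hclose
  simp only [hστ s hs2, hστ t ht2] at this
  calc u t s ≤ C * (τ t - τ s) ^ 2 := this
    _ ≤ max C 0 * ((t - s) * (φ b)⁻¹) ^ 2 := by
      have := sub_nonneg.2 hsm
      gcongr
      exact le_max_left _ _
    _ = _ := by ring

end AbstractEVI

/-! ### From the EVI to the abstract setting -/

theorem expFun_coe {X : Type*} {N : ℝ} {f : X → EReal} {x : X} (hx : x ∈ finDomain f) :
    expFun N f x = ENNReal.ofReal (Real.exp (-(f x).toReal / N)) := by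
  unfold expFun
  conv_lhs => rw [← EReal.coe_toReal hx.2 hx.1]
  rw [← EReal.coe_neg, ← EReal.coe_div, EReal.exp_coe]

theorem slope_lt_of_upperRightDeriv_add_le {u : ℝ → ℝ} {t k c v : ℝ}
    (h : upperRightDeriv u t + (k : EReal) ≤ (c : EReal)) (hv : c - k < v) :
    ∀ᶠ z in 𝓝[>] t, slope u t z < v := by
  have h1 : upperRightDeriv u t < (v : EReal) := by
    refine lt_of_le_of_lt ?_ (EReal.coe_lt_coe_iff.2 hv)
    rw [EReal.coe_sub]
    exact EReal.le_sub_iff_add_le (by simp) (by simp) |>.2 h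
  have h2 := eventually_lt_of_limsup_lt h1
  have h3 : Tendsto (fun z => z - t) (𝓝[>] t) (𝓝[>] 0) := by
    refine tendsto_nhdsWithin_iff.2 ⟨?_, ?_⟩
    · exact ((continuous_sub_right t).tendsto' t 0 (sub_self t)).mono_left nhdsWithin_le_nhds
    · exact eventually_mem_nhdsWithin.mono fun z hz => mem_Ioi.2 (sub_pos.2 hz)
  filter_upwards [h3.eventually h2] with z hz
  rw [slope_def_field]
  simpa using EReal.coe_lt_coe_iff.1 hz

theorem continuous_sKN (K N : ℝ) : Continuous (sKN K N) := by
  unfold sKN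
  split_ifs <;> fun_prop

theorem sKN_zero (K N : ℝ) : sKN K N 0 = 0 := by simp [sKN]

/-- Below the first critical point, `𝔰_{K,N}` is bounded from below by a linear function. -/
theorem mul_le_sKN {K N θ : ℝ} (hN : N < 0) (hθ : 0 ≤ θ)
    (h : K < 0 → θ ≤ Real.pi / 2 * √(N / K)) : 2 / Real.pi * θ ≤ sKN K N θ := by
  have hpi : 2 / Real.pi ≤ 1 := (div_le_one Real.pi_pos).2 Real.two_le_pi
  have hle : 2 / Real.pi * θ ≤ θ := mul_le_of_le_one_left hθ hpi
  unfold sKN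
  split_ifs with hK hK0
  · have hs : 0 < √(K / N) := Real.sqrt_pos.2 (div_pos_of_neg_of_neg hK hN)
    rw [le_div_iff₀ hs, mul_assoc]
    refine Real.mul_le_sin (by positivity) ?_
    have h1 := h hK
    rw [← inv_div K N, Real.sqrt_inv, ← div_eq_mul_inv, le_div_iff₀ hs] at h1
    exact h1
  · exact hle
  · have hs : 0 < √(-K / N) := Real.sqrt_pos.2
      (div_pos_of_neg_of_neg (neg_lt_zero.2 (lt_of_le_of_ne (not_lt.1 hK) (Ne.symm hK0))) hN)
    rw [le_div_iff₀ hs]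
    exact (mul_le_mul_of_nonneg_right hle hs.le).trans (Real.self_le_sinh_iff.2 (by positivity))

theorem mainTheorem8 {X : Type*} [MetricSpace X] (f : X → EReal) (hf : LowerSemicontinuous f)
    (K N : ℝ) (hN : N < 0) (T : EReal) (hT : 0 < T) (y : ℝ → X)
    (hy : IsEVIGradientCurve K N f T y) :
    LocallyLipschitzOn (timeInterval T) y := by
  intro t₀ ht₀
  have hopen : IsOpen (timeInterval T) :=
    (isOpen_lt continuous_const continuous_id).inter
      (isOpen_lt continuous_coe_real_ereal continuous_const)
  -- Within a ball of radius ρ, curve points are admissible in the EVI and half-distances stay below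
  -- the first critical point of 𝔰.
  obtain ⟨ρ, hρ, hρK⟩ : ∃ ρ > 0, K < 0 → ρ + ρ ≤ Real.pi * √(N / K) := by
    by_cases hK : K < 0
    · have : 0 < √(N / K) := Real.sqrt_pos.2 (div_pos_of_neg_of_neg hN hK)
      exact ⟨Real.pi * √(N / K) / 2, by positivity, fun _ => by linarith⟩
    · exact ⟨1, one_pos, fun h => absurd h hK⟩
  have hyc : ContinuousAt y t₀ := hy.continuousOn.continuousAt (hopen.mem_nhds ht₀)
  obtain ⟨η, hη, hball⟩ := Metric.eventually_nhds_iff.1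
    ((hyc.eventually (Metric.ball_mem_nhds _ hρ)).and (hopen.mem_nhds ht₀))
  have hI : ∀ t ∈ Icc (t₀ - η / 2) (t₀ + η / 2), dist (y t) (y t₀) < ρ ∧ t ∈ timeInterval T :=
    fun t ht => hball (by rw [Real.dist_eq, abs_lt]; constructor <;> linarith [ht.1, ht.2])
  set a := t₀ - η / 2 with ha
  set b := t₀ + η / 2 with hb
  have hdist : K < 0 → ∀ s ∈ Icc a b, ∀ t ∈ Icc a b, dist (y s) (y t) < Real.pi * √(N / K) :=
    fun hK s hs t ht => by
      have := dist_triangle_right (y s) (y t) (y t₀)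
      linarith [(hI s hs).1, (hI t ht).1, hρK hK]
  have hlower : ∀ s ∈ Icc a b, ∀ t ∈ Icc a b,
      dist (y s) (y t) ≤ Real.pi * sKN K N (dist (y s) (y t) / 2) := fun s hs t ht => by
    have := mul_le_sKN (K := K) (θ := dist (y s) (y t) / 2) hN (by positivity)
      (fun hK => by linarith [hdist hK s hs t ht])
    rw [div_mul_eq_mul_div, div_le_iff₀ Real.pi_pos] at this
    linarith
  have hdom : ∀ t ∈ Icc a b, y t ∈ finDomain f := fun t ht => hy.mem_domain t (hI t ht).2
  set φ : ℝ → ℝ := fun t => Real.exp (-(f (y t)).toReal / N) with hφ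
  have hlsc : LowerSemicontinuousOn φ (Icc a b) := by
    intro t ht v hv
    rcases le_or_gt v 0 with hv0 | hv0
    · exact Eventually.of_forall fun s => hv0.trans_lt (Real.exp_pos _)
    · have h1 : ((Real.log v * -N : ℝ) : EReal) < f (y t) := by
        rw [← EReal.coe_toReal (hdom t ht).2 (hdom t ht).1, EReal.coe_lt_coe_iff]
        have h2 := (Real.log_lt_iff_lt_exp hv0).2 hv
        rw [lt_div_iff_of_neg hN] at h2
        linarith
      have h3 := (hy.continuousOn t (hI t ht).2).mono fun s hs => (hI s hs).2
      filter_upwards [h3.eventually (hf _ _ h1), eventually_mem_nhdsWithin] with s hs hsI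
      rw [← EReal.coe_toReal (hdom s hsI).2 (hdom s hsI).1, gt_iff_lt, EReal.coe_lt_coe_iff] at hs
      refine (Real.log_lt_iff_lt_exp hv0).1 ?_
      rw [lt_div_iff_of_neg hN]
      linarith
  have hratio : ∀ r ∈ Icc a b, ∀ c ∈ Icc a b,
      ((expFun N f (y c) / expFun N f (y r) : ENNReal) : EReal) = ((φ c / φ r : ℝ) : EReal) := by
    intro r hr c hc
    rw [expFun_coe (hdom r hr), expFun_coe (hdom c hc),
      ← ENNReal.ofReal_div_of_pos (Real.exp_pos _), EReal.coe_ennreal_ofReal,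
      max_eq_left (by positivity)]
  obtain ⟨C, δ, hδ, hC⟩ := exists_le_mul_sq_of_evi
    (u := fun p q => sKN K N (dist (y p) (y q) / 2) ^ 2) (φ := φ) (κ := |K|) (m := -N / 2)
    (a := a) (b := b) (t₀ := t₀) (abs_nonneg K) (by linarith)
    (fun p q => by simp only [dist_comm]) (fun p q => sq_nonneg _)
    (fun p => by simp [sKN_zero])
    (fun c hc => (show Continuous fun x => sKN K N (dist x (y c) / 2) ^ 2 from
      ((continuous_sKN K N).comp (by fun_prop)).pow 2).comp_continuousOn
        (hy.continuousOn.mono fun s hs => (hI s hs).2))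
    (fun t _ => Real.exp_pos _) hlsc
    (fun p hp q hq hpq => by
      have h1 := hlower p hp q hq
      rw [pow_eq_zero_iff two_ne_zero |>.1 hpq, mul_zero] at h1
      simp only [hφ, dist_le_zero.1 h1])
    (fun r hr c hc v hv => by
      have hrI : r ∈ Icc a b := ⟨hr.1, hr.2.le⟩
      have h1 := hy.evi r (hI r hrI).2 (y c) (subset_closure (hdom c hc))
        (fun hK => hdist hK r hrI c hc)
      rw [hratio r hrI c hc, ← EReal.coe_one, ← EReal.coe_sub, ← EReal.coe_mul] at h1
      refine slope_lt_of_upperRightDeriv_add_le h1 (lt_of_le_of_lt ?_ hv)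
      have := mul_le_mul_of_nonneg_right (neg_le_abs K)
        (sq_nonneg (sKN K N (dist (y r) (y c) / 2)))
      linarith)
    ⟨by linarith, by linarith⟩
  have hbound : ∀ s ∈ Icc a b, ∀ t ∈ Icc a b, |s - t₀| < δ → |t - t₀| < δ → s ≤ t →
      dist (y t) (y s) ≤ Real.pi * √(max C 0) * |t - s| := by
    intro s hs t ht hs' ht' hst
    have h1 : sKN K N (dist (y t) (y s) / 2) ^ 2 ≤ max C 0 * (t - s) ^ 2 :=
      (hC s t hs' ht' hst).trans (mul_le_mul_of_nonneg_right (le_max_left _ _) (sq_nonneg _))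
    have h2 := Real.abs_le_sqrt h1
    rw [Real.sqrt_mul (le_max_right _ _), Real.sqrt_sq_eq_abs] at h2
    rw [mul_assoc]
    exact (hlower t ht s hs).trans
      (mul_le_mul_of_nonneg_left ((le_abs_self _).trans h2) Real.pi_pos.le)
  refine ⟨(Real.pi * √(max C 0)).toNNReal, Icc a b ∩ Metric.ball t₀ δ,
    mem_nhdsWithin_of_mem_nhds (inter_mem (Icc_mem_nhds (by linarith) (by linarith))
      (Metric.ball_mem_nhds _ hδ)), LipschitzOnWith.of_dist_le_mul fun s hs t ht => ?_⟩
  have hs' : |s - t₀| < δ := hs.2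
  have ht' : |t - t₀| < δ := ht.2
  rw [Real.coe_toNNReal _ (by positivity), Real.dist_eq]
  rcases le_total s t with h | h
  · rw [dist_comm, abs_sub_comm]
    exact hbound s hs.1 t ht.1 hs' ht' h
  · exact hbound t ht.1 s hs.1 ht' hs' h
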